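/- Let $\mathbb{F}_q$ be a finite field and let $n,k$ be integers with $3\le k\le n-2\le q-2$. Let $S=\{a_1,\dots,a_n\}$ with $a_1,\dots,a_n\in\mathbb{F}_q$ distinct, let $v=(v_1,\dots,v_n)\in(\mathbb{F}_q^*)^n$, and let $u=(u_1,\dots,u_n)$ with $u_i=\prod_{j\ne i}(a_i-a_j)^{-1}$. All codes are linear over $\mathbb{F}_q$; $d(C)$ is the minimum distance of a code $C$ ($d(\{0\})=\infty$), $C^\perp$ its dual for the standard product, $\star$ the componentwise product, $x^{-1}$ the componentwise inverse of a vector $x$, and $A\star B=\{x\star y: x\in A,\ y\in B\}$. For codes $A,B,C$ of length $N$, the pair $(A,B)$ is an $\ell$-error-correcting pair ($\ell$-ECP) of $C$ if $A\star B\subseteq C^\perp$, $d(B^\perp)>\ell$, $\dim A>\ell$ and $d(A)+d(C)>N$. For a sequence $S=(a_1,\dots,a_m)$ and $w\in\mathbb{F}_q^m$ put $$\mathrm{GRS}_r(S,w)=\{(w_1f(a_1),\dots,w_mf(a_m)):\deg f<r\},$$ $$\mathrm{GRS}_r(S,w,\infty)=\{(w_1f(a_1),\dots,w_mf(a_m),f_{r-1}):\deg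 f<r\},$$ where $f_i$ is the coefficient of $x^i$ in $f\in\mathbb{F}_q[x]$. The extended Han–Zhang code is $$\mathcal{C}_k(S,v,\infty)=\{(v_1f(a_1),\dots,v_nf(a_n),f_k): \deg f\le k,\ f_{k-1}=0\}\subseteq\mathbb{F}_q^{n+1}.$$ Let $\ell=\lfloor (d(\mathcal{C}_k(S,v,\infty))-1)/2\rfloor$, and assume that $S$ is $k$-zero-sum free, i.e. no $k$ distinct elements of $S$ sum to $0$. Then $\mathcal{C}_k(S,v,\infty)$ is an $[n+1,k,n-k+2]_q$ MDS code, and the following hold. 1) If $n-k$ is odd, then $\mathcal{C}_k(S,v,\infty)$ has no $\ell$-ECP. Moreover $\mathbb{F}_q\setminus S\ne\emptyset$, and for every $\gamma\in\mathbb{F}_q\setminus S$ the pair $$\bigl(\mathrm{GRS}_\ell(S',\mathbf 1),\ \mathrm{GRS}_{\ell-1}(S',v'^{-1}\star u')\bigr)$$ is an $(\ell-1)$-ECP of $\mathcal{C}_k(S,v,\infty)$, where $S'=((a_1-\gamma)^{-1},\dots,(a_n-\gamma)^{-1},0)$, $v'=(v_1(a_1-\gamma)^k,\dots,v_n(a_n-\gamma)^k,1)$,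 and $u'=(u'_1,\dots,u'_{n+1})$ with $u'_i=(a_i-\gamma)^n\prod_{1\le j\le n,\,j\ne i}(a_j-\gamma)(a_j-a_i)^{-1}$ for $1\le i\le n$ and $u'_{n+1}=(-1)^n\prod_{j=1}^n(a_j-\gamma)$. 2) If $n-k$ is even, then the pair $$\bigl(\mathrm{GRS}_{\ell+1}(S,\mathbf 1,\infty),\ \mathrm{GRS}_\ell(S,v^{-1}\star u,\infty)\,\mathrm{diag}(1,\dots,1,-1)\bigr)$$ is an $\ell$-ECP of $\mathcal{C}_k(S,v,\infty)$, where $\mathrm{diag}(1,\dots,1,-1)$ has $n$ entries $1$ and $CM=\{cM:c\in C\}$. -/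

import Mathlib

open Polynomial

namespace CodingECP

variable {F : Type*} [Field F]

/-- The dual code with respect to the standard product `∑ i, x i * y i`. -/
def dualCode {N : ℕ} (C : Submodule F (Fin N → F)) : Submodule F (Fin N → F) where
  carrier := {y | ∀ x ∈ C, ∑ i, x i * y i = 0}
  add_mem' := by
    intro y z hy hz x hx
    simp only [Pi.add_apply, mul_add, Finset.sum_add_distrib]
    rw [hy x hx, hz x hx, add_zero]
  zero_mem' := by
    intro x _
    simp
  smul_mem' := by
    intro c y hy x hx
    have h : ∑ i, x i * (c • y) i = c * ∑ i, x i * y i := by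
      rw [Finset.mul_sum]
      refine Finset.sum_congr rfl fun i _ => ?_
      simp only [Pi.smul_apply, smul_eq_mul]
      ring
    rw [h, hy x hx, mul_zero]

/-- The Schur (componentwise) product of two codes: the set of all products of codewords. -/
def schurProduct {N : ℕ} (A B : Submodule F (Fin N → F)) : Set (Fin N → F) :=
  {w | ∃ x ∈ A, ∃ y ∈ B, w = x * y}

/-- The minimum distance of a linear code, i.e. the least Hamming weight of a nonzero codeword;
the zero code has minimum distance `⊤`. -/
noncomputable def minDist [DecidableEq F] {N : ℕ} (C : Submodule F (Fin N → F)) : ℕ∞ :=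
  ⨅ x : {x : Fin N → F // x ∈ C ∧ x ≠ 0}, (hammingNorm x.1 : ℕ∞)

/-- `(A, B)` is an `ℓ`-error-locating pair of `C`. -/
structure IsELP [DecidableEq F] {N : ℕ} (ℓ : ℕ) (C A B : Submodule F (Fin N → F)) : Prop where
  schur_subset : schurProduct A B ⊆ (dualCode C : Set (Fin N → F))
  lt_minDist_dual : (ℓ : ℕ∞) < minDist (dualCode B)
  lt_finrank : ℓ < Module.finrank F A

/-- `(A, B)` is an `ℓ`-error-correcting pair of `C`. -/
structure IsECP [DecidableEq F] {N : ℕ} (ℓ : ℕ) (C A B : Submodule F (Fin N → F)) : Prop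
    extends IsELP ℓ C A B where
  lt_minDist_add : (N : ℕ∞) < minDist A + minDist C

/-- `f ↦ (v₁ f(a₁), …, vₙ f(aₙ))`. -/
noncomputable def evalWord {n : ℕ} (a v : Fin n → F) : F[X] →ₗ[F] (Fin n → F) where
  toFun f := fun i => v i * f.eval (a i)
  map_add' f g := by
    ext i
    simp [mul_add]
  map_smul' c f := by
    ext i
    simp only [eval_smul, smul_eq_mul, RingHom.id_apply, Pi.smul_apply]
    ring

/-- `f ↦ (v₁ f(a₁), …, vₙ f(aₙ), f_m)`, where `f_m` is the coefficient of `x ^ m` in `f`. -/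
noncomputable def evalWordExt {n : ℕ} (a v : Fin n → F) (m : ℕ) :
    F[X] →ₗ[F] (Fin (n + 1) → F) where
  toFun f := Fin.snoc (α := fun _ => F) (fun i => v i * f.eval (a i)) (f.coeff m)
  map_add' f g := by
    ext i
    refine Fin.lastCases ?_ (fun j => ?_) i
    · simp
    · simp [mul_add]
  map_smul' c f := by
    ext i
    refine Fin.lastCases ?_ (fun j => ?_) i
    · simp
    · simp only [Fin.snoc_castSucc, eval_smul, smul_eq_mul, RingHom.id_apply, Pi.smul_apply]
      ring

/-- The generalized Reed-Solomon code `GRS_k(S, v)`, with evaluation-point sequence `a`. -/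
noncomputable def GRS {n : ℕ} (k : ℕ) (a v : Fin n → F) : Submodule F (Fin n → F) :=
  (degreeLT F k).map (evalWord a v)

/-- The extended generalized Reed-Solomon code `GRS_k(S, v, ∞)` (for `k ≥ 1`). -/
noncomputable def EGRS {n : ℕ} (k : ℕ) (a v : Fin n → F) : Submodule F (Fin (n + 1) → F) :=
  (degreeLT F k).map (evalWordExt a v (k - 1))

/-- The space `V_k` of polynomials of degree at most `k` with no term in `x ^ (k - 1)`
(for `k ≥ 1`). -/
noncomputable def twistedPoly (F : Type*) [Field F] (k : ℕ) : Submodule F F[X] :=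
  degreeLT F (k + 1) ⊓ LinearMap.ker (lcoeff F (k - 1))

/-- The extended Han-Zhang code `C_k(S, v, ∞)`. -/
noncomputable def extHanZhang {n : ℕ} (k : ℕ) (a v : Fin n → F) :
    Submodule F (Fin (n + 1) → F) :=
  (twistedPoly F k).map (evalWordExt a v k)

/-- The code `C M = {c M : c ∈ C}`. -/
def codeMulMatrix {N : ℕ} (C : Submodule F (Fin N → F)) (M : Matrix (Fin N) (Fin N) F) :
    Submodule F (Fin N → F) :=
  C.map M.vecMulLinear

/-- The matrix `diag(1, …, 1, -1)` of size `n + 1`. -/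
def diagNegLast (F : Type*) [Field F] (n : ℕ) : Matrix (Fin (n + 1)) (Fin (n + 1)) F :=
  Matrix.diagonal (Fin.snoc (α := fun _ => F) (fun _ : Fin n => (1 : F)) (-1))

/-- No `k` distinct elements of `S` sum to zero. -/
def ZeroSumFree (k : ℕ) (S : Set F) : Prop :=
  ∀ T : Finset F, (T : Set F) ⊆ S → T.card = k → ∑ x ∈ T, x ≠ 0

/-- `u_i = ∏_{j ≠ i} (a_i - a_j)⁻¹`. -/
def uVec {n : ℕ} (a : Fin n → F) : Fin n → F :=
  fun i => ∏ j ∈ Finset.univ.erase i, (a i - a j)⁻¹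

/-- `S' = ((a_1 - γ)⁻¹, …, (a_n - γ)⁻¹, 0)`. -/
def aPrime {n : ℕ} (a : Fin n → F) (γ : F) : Fin (n + 1) → F :=
  Fin.snoc (α := fun _ => F) (fun i => (a i - γ)⁻¹) 0

/-- `v' = (v_1 (a_1 - γ) ^ k, …, v_n (a_n - γ) ^ k, 1)`. -/
def vPrime {n : ℕ} (k : ℕ) (a v : Fin n → F) (γ : F) : Fin (n + 1) → F :=
  Fin.snoc (α := fun _ => F) (fun i => v i * (a i - γ) ^ k) 1

/-- `u'_i = (a_i - γ) ^ n ∏_{j ≠ i} (a_j - γ) (a_j - a_i)⁻¹` for `i ≤ n`, and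
`u'_{n + 1} = (-1) ^ n ∏_j (a_j - γ)`. -/
def uPrime {n : ℕ} (a : Fin n → F) (γ : F) : Fin (n + 1) → F :=
  Fin.snoc (α := fun _ => F)
    (fun i => (a i - γ) ^ n * ∏ j ∈ Finset.univ.erase i, ((a j - γ) * (a j - a i)⁻¹))
    ((-1) ^ n * ∏ j, (a j - γ))

end CodingECP

/-! The code is MDS because a polynomial with `f_k ≠ 0` and `k` zeros in `S` is a multiple of the
product of its linear factors; by Vieta, `f_{k-1} = 0` would make those zeros sum to 0
(`le_hammingNorm_extHanZhang`).

Duality rests on Lagrange's identity: if `deg P < n`, then `∑ u_i P(a_i)` is the coefficient of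
`x^(n-1)` in `P`. For `n - k` even, the product of the three polynomials involved has degree at most
`n - 1`, and its top coefficient is the product of the coordinates at infinity, cancelled by the
sign in the diagonal matrix. For `n - k` odd, `x ↦ 1/(x - γ)` moves infinity to 0 and embeds the
code in `GRS_{k+1}(S', v')`, where the degrees are too small to leave a top coefficient. A point `γ`
exists: if `S` were the whole field, `k` distinct elements would sum to 0 unless the characteristic
is two and `k` is even, which is excluded by `n = q` and parity.

Nonexistence (`not_isELP_extHanZhang`): here `n - k = 2ℓ - 1`, and a dual word vanishing on a set
`T` of `n - k` affine positions is fixed up to a scalar `c`, with last coordinate `-c (∑ a_i - ∑_T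
a_i)`. Words `z₀, z₁` of `A` and `b₂, b₃` of `B` with suitable zeros have four such products.
Comparing them at a common affine position shows that the matrix `(c_st)` has determinant 0;
comparing last coordinates shows the same for `(c_st (σ - a_s - a_t))`. Together these force `(a_0 -
a_1)(a_2 - a_3) = 0`. -/

namespace CodingECP

variable {F : Type*} [Field F]

/-! ### Hamming weight and dual distance -/

section Weight

variable [DecidableEq F]

theorem le_minDist {N m : ℕ} {C : Submodule F (Fin N → F)}
    (h : ∀ x ∈ C, x ≠ 0 → m ≤ hammingNorm x) : (m : ℕ∞) ≤ minDist C :=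
  le_iInf fun x => by exact_mod_cast h x.1 x.2.1 x.2.2

theorem minDist_le {N : ℕ} {C : Submodule F (Fin N → F)} {x : Fin N → F}
    (hx : x ∈ C) (h0 : x ≠ 0) : minDist C ≤ hammingNorm x :=
  iInf_le (fun x : {x : Fin N → F // x ∈ C ∧ x ≠ 0} => (hammingNorm x.1 : ℕ∞)) ⟨x, hx, h0⟩

theorem hammingNorm_add_card_zeros {N : ℕ} (x : Fin N → F) :
    hammingNorm x + (Finset.univ.filter fun i => x i = 0).card = N := by
  have := Finset.card_filter_add_card_filter_not (s := (Finset.univ : Finset (Fin N)))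
    (fun i => x i ≠ 0)
  simpa [hammingNorm] using this

theorem hammingNorm_snoc {n : ℕ} (x : Fin n → F) (c : F) :
    hammingNorm (Fin.snoc (α := fun _ => F) x c) = hammingNorm x + if c = 0 then 0 else 1 := by
  simp [hammingNorm, Finset.card_filter, Fin.sum_univ_castSucc]

/-- A code separating each position of every set of at most `r` positions has dual distance
exceeding `r`. -/
theorem lt_minDist_dualCode {N r : ℕ} {C : Submodule F (Fin N → F)}
    (h : ∀ T : Finset (Fin N), T.card ≤ r → ∀ i ∈ T,
      ∃ x ∈ C, x i ≠ 0 ∧ ∀ j ∈ T, j ≠ i → x j = 0) :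
    (r : ℕ∞) < minDist (dualCode C) := by
  refine lt_of_lt_of_le (b := ((r + 1 : ℕ) : ℕ∞)) (by exact_mod_cast r.lt_succ_self)
    (le_minDist fun y hy h0 => ?_)
  by_contra! hlt
  obtain ⟨i, hi⟩ : ∃ i, y i ≠ 0 := by
    by_contra! h'
    exact h0 (funext h')
  -- A codeword meeting the support of `y` only at `i` pairs with `y` to `x i * y i ≠ 0`.
  obtain ⟨x, hx, hxi, hxj⟩ := h (Finset.univ.filter fun i => y i ≠ 0)
    (by simpa [hammingNorm] using Nat.lt_succ_iff.1 hlt) i (by simpa using hi)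
  have := hy x hx
  rw [Finset.sum_eq_single i] at this
  · exact mul_ne_zero hxi hi this
  · intro j _ hji
    by_cases hj : y j = 0
    · rw [hj, mul_zero]
    · rw [hxj j (by simpa using hj) hji, zero_mul]
  · simp

/-- A code with dual distance exceeding `r` projects onto any set of at most `r` positions. -/
theorem exists_mem_eq_one_of_lt_minDist_dualCode {N r : ℕ} {C : Submodule F (Fin N → F)}
    (h : (r : ℕ∞) < minDist (dualCode C)) {J : Finset (Fin N)} (hJ : J.card < r) {i : Fin N}
    (hi : i ∉ J) : ∃ x ∈ C, x i = 1 ∧ ∀ j ∈ J, x j = 0 := by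
  classical
  -- If the unit vector at `i` is not in `C ⊔ W`, a functional killing `C ⊔ W` but not that vector
  -- is, in coordinates, a nonzero dual word supported on `insert i J`, hence of weight at most `r`.
  let W : Submodule F (Fin N → F) :=
    { carrier := {x | ∀ j ∈ insert i J, x j = 0}
      add_mem' := fun hx hy j hj => by simp [hx j hj, hy j hj]
      zero_mem' := fun j _ => rfl
      smul_mem' := fun c x hx j hj => by simp [hx j hj] }
  by_cases hmem : (Pi.single i 1 : Fin N → F) ∈ C ⊔ W
  · obtain ⟨x, hx, w, hw, hxw⟩ := Submodule.mem_sup.1 hmem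
    have key : ∀ j ∈ insert i J, x j = (Pi.single i 1 : Fin N → F) j := fun j hj => by
      rw [← hxw, Pi.add_apply, hw j hj, add_zero]
    refine ⟨x, hx, by simpa using key i (by simp), fun j hj => ?_⟩
    rw [key j (by simp [hj]), Pi.single_eq_of_ne]
    rintro rfl
    exact hi hj
  · exfalso
    obtain ⟨φ, hφi, hφ⟩ := Submodule.exists_le_ker_of_notMem hmem
    let y : Fin N → F := fun j => φ (Pi.single j 1)
    have hsum : ∀ x : Fin N → F, ∑ j, x j * y j = φ x := fun x => by
      conv_rhs => rw [← Finset.univ_sum_single x, map_sum]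
      refine Finset.sum_congr rfl fun j _ => ?_
      rw [← mul_one (x j), ← smul_eq_mul (x j) 1, Pi.single_smul, map_smul]
      simp [y]
    have hy : y ∈ dualCode C := fun x hx => by
      rw [hsum]
      exact hφ (Submodule.mem_sup_left hx)
    have hy0 : y ≠ 0 := fun h0 => hφi (congrFun h0 i)
    have hle : hammingNorm y ≤ (insert i J).card := by
      refine Finset.card_le_card fun j hj => ?_
      by_contra hjJ
      have : φ (Pi.single j 1) = 0 := hφ (Submodule.mem_sup_right fun l hl => by
        rw [Pi.single_eq_of_ne]
        rintro rfl
        exact hjJ hl)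
      simp [y, this] at hj
    have h1 := lt_of_lt_of_le h (minDist_le hy hy0)
    rw [Nat.cast_lt] at h1
    have := Finset.card_insert_le i J
    omega

end Weight

/-! ### Evaluation words, their zeros and dimensions -/

theorem evalWord_apply {n : ℕ} (a v : Fin n → F) (f : F[X]) (i : Fin n) :
    evalWord a v f i = v i * f.eval (a i) := rfl

theorem evalWordExt_eq_snoc {n : ℕ} (a v : Fin n → F) (m : ℕ) (f : F[X]) :
    evalWordExt a v m f = Fin.snoc (α := fun _ => F) (evalWord a v f) (f.coeff m) := rfl

@[simp]
theorem evalWordExt_castSucc {n : ℕ} (a v : Fin n → F) (m : ℕ) (f : F[X]) (i : Fin n) :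
    evalWordExt a v m f i.castSucc = v i * f.eval (a i) := by
  rw [evalWordExt_eq_snoc, Fin.snoc_castSucc, evalWord_apply]

@[simp]
theorem evalWordExt_last {n : ℕ} (a v : Fin n → F) (m : ℕ) (f : F[X]) :
    evalWordExt a v m f (Fin.last n) = f.coeff m := by
  rw [evalWordExt_eq_snoc, Fin.snoc_last]

theorem natDegree_lt_of_mem_degreeLT {r : ℕ} {f : F[X]} (hf : f ∈ degreeLT F r) (h0 : f ≠ 0) :
    f.natDegree < r :=
  (natDegree_lt_iff_degree_lt h0).2 (mem_degreeLT.1 hf)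

theorem mem_degreeLT_of_natDegree_lt {r : ℕ} {f : F[X]} (hf : f.natDegree < r) :
    f ∈ degreeLT F r :=
  mem_degreeLT.2 (lt_of_le_of_lt degree_le_natDegree (by exact_mod_cast hf))

theorem mem_twistedPoly {k : ℕ} {f : F[X]} :
    f ∈ twistedPoly F k ↔ f.natDegree ≤ k ∧ f.coeff (k - 1) = 0 := by
  rw [twistedPoly, Submodule.mem_inf, LinearMap.mem_ker, lcoeff_apply, mem_degreeLT,
    degree_lt_iff_coeff_zero, natDegree_le_iff_coeff_eq_zero]
  rfl

theorem card_zeros_le_natDegree [DecidableEq F] {n : ℕ} {a : Fin n → F}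
    (ha : Function.Injective a)
    {f : F[X]} (h0 : f ≠ 0) :
    (Finset.univ.filter fun i => f.eval (a i) = 0).card ≤ f.natDegree := by
  refine le_trans ?_ ((Multiset.toFinset_card_le _).trans (card_roots' f))
  refine Finset.card_le_card_of_injOn a (fun i hi => ?_) ha.injOn
  simpa [h0] using hi

theorem coeff_card_nodal {n : ℕ} (a : Fin n → F) (Z : Finset (Fin n)) :
    (Lagrange.nodal Z a).coeff Z.card = 1 := by
  simpa [Lagrange.natDegree_nodal] using
    (Lagrange.nodal_monic (s := Z) (v := a)).coeff_natDegree

theorem eq_C_coeff_mul_nodal {n : ℕ} {a : Fin n → F} (ha : Function.Injective a)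
    {Z : Finset (Fin n)} {f : F[X]} (hf : f.natDegree ≤ Z.card)
    (hZ : ∀ i ∈ Z, f.eval (a i) = 0) :
    f = C (f.coeff Z.card) * Lagrange.nodal Z a := by
  refine Polynomial.eq_of_degree_sub_lt_of_eval_index_eq Z ha.injOn ?_ fun i hi => ?_
  · rw [degree_lt_iff_coeff_zero]
    intro m hm
    rw [coeff_sub, coeff_C_mul]
    rcases hm.eq_or_lt with rfl | hm
    · rw [coeff_card_nodal, mul_one, sub_self]
    · have : (Lagrange.nodal Z a).coeff m = 0 :=
        coeff_eq_zero_of_natDegree_lt (by rwa [Lagrange.natDegree_nodal])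
      rw [coeff_eq_zero_of_natDegree_lt (hf.trans_lt hm), this, mul_zero, sub_self]
  · rw [hZ i hi, eval_mul, Lagrange.eval_nodal_at_node hi, mul_zero]

theorem le_hammingNorm_evalWord [DecidableEq F] {n : ℕ} {a v : Fin n → F}
    (ha : Function.Injective a)
    (hv : ∀ i, v i ≠ 0) {f : F[X]} (h0 : f ≠ 0) :
    n ≤ hammingNorm (evalWord a v f) + f.natDegree := by
  have h1 := hammingNorm_add_card_zeros (evalWord a v f)
  have h2 := card_zeros_le_natDegree ha h0
  simp only [evalWord_apply, mul_eq_zero, hv, false_or] at h1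
  omega

theorem le_hammingNorm_evalWordExt [DecidableEq F] {n : ℕ} {a v : Fin n → F}
    (ha : Function.Injective a)
    (hv : ∀ i, v i ≠ 0) {r : ℕ} {f : F[X]} (h0 : f ≠ 0) (hf : f ∈ degreeLT F r) :
    n + 1 ≤ hammingNorm (evalWordExt a v (r - 1) f) + (r - 1) := by
  have h1 := le_hammingNorm_evalWord ha hv h0
  have h2 := natDegree_lt_of_mem_degreeLT hf h0
  rw [evalWordExt_eq_snoc, hammingNorm_snoc]
  split_ifs with hc
  · have : f.natDegree ≠ r - 1 := fun h => by
      rw [← h, coeff_natDegree, leadingCoeff_eq_zero] at hc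
      exact h0 hc
    omega
  · omega

/-- The zero-sum-free condition makes every nonzero word of the extended Han-Zhang code vanish in
fewer than `k` positions. -/
theorem le_hammingNorm_extHanZhang [DecidableEq F] {n k : ℕ} (hk : 2 ≤ k) {a v : Fin n → F}
    (ha : Function.Injective a) (hv : ∀ i, v i ≠ 0) (hS : ZeroSumFree k (Set.range a))
    {f : F[X]} (h0 : f ≠ 0) (hf : f ∈ twistedPoly F k) :
    n + 1 ≤ hammingNorm (evalWordExt a v k f) + (k - 1) := by
  obtain ⟨hdeg, hcoeff⟩ := mem_twistedPoly.1 hf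
  have hne : f.natDegree ≠ k - 1 := fun h => by
    rw [← h, coeff_natDegree, leadingCoeff_eq_zero] at hcoeff
    exact h0 hcoeff
  rw [evalWordExt_eq_snoc, hammingNorm_snoc]
  split_ifs with hc
  -- The last position is now a zero as well, but the degree drops to at most `k - 2`.
  · have h1 := le_hammingNorm_evalWord ha hv h0
    have : f.natDegree ≠ k := fun h => by
      rw [← h, coeff_natDegree, leadingCoeff_eq_zero] at hc
      exact h0 hc
    omega
  · have hdk : f.natDegree = k := le_antisymm hdeg (le_natDegree_of_ne_zero hc)
    have h1 := hammingNorm_add_card_zeros (evalWord a v f)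
    have h2 := card_zeros_le_natDegree ha h0
    simp only [evalWord_apply, mul_eq_zero, hv, false_or] at h1
    rcases h2.lt_or_eq with h2 | h2
    · change n + 1 ≤ hammingNorm (evalWord a v f) + 1 + (k - 1)
      omega
    exfalso
    set Z := Finset.univ.filter fun i => f.eval (a i) = 0
    have hZ : Z.card = k := h2.trans hdk
    -- The `k` zeros exhaust the degree, so Vieta gives `f_{k-1}` as `-f_k` times their sum.
    have hfac := eq_C_coeff_mul_nodal ha (Z := Z) h2.ge fun i hi => by simpa [Z] using hi
    have hsum := prod_X_sub_C_coeff_card_pred Z a (by omega)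
    rw [hfac, coeff_C_mul, ← hZ, Lagrange.nodal_eq, hsum, hZ] at hcoeff
    refine hS (Z.image a) (by simp) (by rw [Finset.card_image_of_injective _ ha, hZ]) ?_
    rw [Finset.sum_image ha.injOn]
    simpa [hc] using hcoeff

theorem finrank_map_of_forall_ne_zero {V W : Type*} [AddCommGroup V] [Module F V]
    [AddCommGroup W] [Module F W] {S : Submodule F V} {φ : V →ₗ[F] W}
    (h : ∀ f ∈ S, f ≠ 0 → φ f ≠ 0) : Module.finrank F (S.map φ) = Module.finrank F S := by
  rw [← LinearMap.range_domRestrict]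
  refine LinearMap.finrank_range_of_inj ((injective_iff_map_eq_zero _).2 fun x hx => ?_)
  by_contra h0
  exact h x.1 x.2 (by simpa using h0) hx

theorem finrank_degreeLT (r : ℕ) : Module.finrank F (degreeLT F r) = r := by
  rw [(degreeLTEquiv F r).finrank_eq, Module.finrank_fin_fun]

theorem finrank_twistedPoly {k : ℕ} (hk : 1 ≤ k) : Module.finrank F (twistedPoly F k) = k := by
  let φ := (lcoeff F (k - 1)).domRestrict (degreeLT F (k + 1))
  have : FiniteDimensional F (degreeLT F (k + 1)) :=
    Module.Finite.equiv (degreeLTEquiv F (k + 1)).symm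
  have hker : (LinearMap.ker φ).map (degreeLT F (k + 1)).subtype = twistedPoly F k := by
    rw [LinearMap.ker_domRestrict, twistedPoly]
    exact Submodule.map_comap_subtype _ _
  have hsurj : Function.Surjective φ := fun c => by
    refine ⟨⟨C c * X ^ (k - 1), mem_degreeLT_of_natDegree_lt ?_⟩, ?_⟩
    · exact lt_of_le_of_lt (natDegree_C_mul_X_pow_le _ _) (by omega)
    · simp [φ]
  have h1 := φ.finrank_range_add_finrank_ker
  rw [LinearMap.range_eq_top.2 hsurj, finrank_top, finrank_degreeLT, Module.finrank_self] at h1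
  rw [← hker, Submodule.finrank_map_subtype_eq]
  omega

/-! ### Lagrange's identity for the weights `u` -/

theorem uVec_ne_zero {n : ℕ} {a : Fin n → F} (ha : Function.Injective a) (i : Fin n) :
    uVec a i ≠ 0 :=
  Finset.prod_ne_zero_iff.2 fun _ hj =>
    inv_ne_zero (sub_ne_zero.2 fun h => (Finset.ne_of_mem_erase hj) (ha h).symm)

theorem sum_uVec_mul_eval {n : ℕ} {a : Fin n → F} (ha : Function.Injective a) {P : F[X]}
    (hP : P.natDegree < n) : ∑ i, uVec a i * P.eval (a i) = P.coeff (n - 1) := by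
  have hdeg : P.degree < (Finset.univ : Finset (Fin n)).card := by
    rw [Finset.card_fin]
    exact lt_of_le_of_lt degree_le_natDegree (by exact_mod_cast hP)
  have h := Lagrange.coeff_eq_sum ha.injOn hdeg
  rw [Finset.card_fin] at h
  rw [h]
  refine Finset.sum_congr rfl fun i _ => ?_
  rw [uVec, Finset.prod_inv_distrib, div_eq_inv_mul]

/-- Subtracting `P_n` times the nodal polynomial of all points lowers the degree without changing
any value; Vieta supplies the correction. Degree `n` occurs when a dual word is tested against `X ^
k`. -/
theorem sum_uVec_mul_eval_of_natDegree_le {n : ℕ} (hn : 1 ≤ n) {a : Fin n → F}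
    (ha : Function.Injective a) {P : F[X]} (hP : P.natDegree ≤ n) :
    ∑ i, uVec a i * P.eval (a i) = P.coeff (n - 1) + P.coeff n * ∑ i, a i := by
  set N := Lagrange.nodal Finset.univ a
  have hN : N.natDegree = n := by rw [Lagrange.natDegree_nodal, Finset.card_fin]
  have hN1 : N.coeff n = 1 := by
    simpa using coeff_card_nodal a Finset.univ
  have hN2 : N.coeff (n - 1) = -∑ i, a i := by
    have := prod_X_sub_C_coeff_card_pred Finset.univ a
      (by rw [Finset.card_fin]; omega)
    rwa [Finset.card_fin, ← Lagrange.nodal_eq] at this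
  have hdeg : (P - C (P.coeff n) * N).natDegree < n := by
    refine lt_of_le_of_lt (natDegree_le_iff_coeff_eq_zero.2 fun m hm => ?_) (Nat.sub_one_lt_of_lt hn)
    rw [coeff_sub, coeff_C_mul]
    rcases (show n ≤ m by omega).eq_or_lt with rfl | hm
    · rw [hN1, mul_one, sub_self]
    · rw [coeff_eq_zero_of_natDegree_lt (hP.trans_lt hm),
        coeff_eq_zero_of_natDegree_lt (hN.trans_lt hm), mul_zero, sub_self]
  have h := sum_uVec_mul_eval ha hdeg
  rw [coeff_sub, coeff_C_mul, hN2] at h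
  rw [show P.coeff (n - 1) + P.coeff n * ∑ i, a i
    = P.coeff (n - 1) - P.coeff n * -∑ i, a i by ring, ← h]
  refine Finset.sum_congr rfl fun i _ => ?_
  rw [eval_sub, eval_mul, Lagrange.eval_nodal_at_node (Finset.mem_univ i), mul_zero, sub_zero]

/-! ### Parameters of the codes -/

section Codes

theorem evalWord_ne_zero {n r : ℕ} (hr : r ≤ n) {a v : Fin n → F} (ha : Function.Injective a)
    (hv : ∀ i, v i ≠ 0) {f : F[X]} (hf : f ∈ degreeLT F r) (h0 : f ≠ 0) :
    evalWord a v f ≠ 0 := by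
  classical
  have h1 := le_hammingNorm_evalWord ha hv h0
  have h2 := natDegree_lt_of_mem_degreeLT hf h0
  exact hammingNorm_ne_zero_iff.1 (by omega)

theorem evalWordExt_ne_zero {n r : ℕ} (hr : r ≤ n + 1) {a v : Fin n → F}
    (ha : Function.Injective a) (hv : ∀ i, v i ≠ 0) {f : F[X]} (hf : f ∈ degreeLT F r)
    (h0 : f ≠ 0) : evalWordExt a v (r - 1) f ≠ 0 := by
  classical
  have h1 := le_hammingNorm_evalWordExt ha hv h0 hf
  have h2 := natDegree_lt_of_mem_degreeLT hf h0
  exact hammingNorm_ne_zero_iff.1 (by omega)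

theorem finrank_GRS {n r : ℕ} (hr : r ≤ n) {a v : Fin n → F} (ha : Function.Injective a)
    (hv : ∀ i, v i ≠ 0) : Module.finrank F (GRS r a v) = r := by
  rw [GRS, finrank_map_of_forall_ne_zero fun f hf h0 => evalWord_ne_zero hr ha hv hf h0,
    finrank_degreeLT]

theorem finrank_EGRS {n r : ℕ} (hr : r ≤ n + 1) {a v : Fin n → F} (ha : Function.Injective a)
    (hv : ∀ i, v i ≠ 0) : Module.finrank F (EGRS r a v) = r := by
  rw [EGRS, finrank_map_of_forall_ne_zero fun f hf h0 => evalWordExt_ne_zero hr ha hv hf h0,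
    finrank_degreeLT]

theorem nodal_mem_degreeLT {n r : ℕ} (a : Fin n → F) {Z : Finset (Fin n)} (hZ : Z.card < r) :
    Lagrange.nodal Z a ∈ degreeLT F r :=
  mem_degreeLT_of_natDegree_lt (by rwa [Lagrange.natDegree_nodal])

theorem eval_nodal_ne_zero {n : ℕ} {a : Fin n → F} (ha : Function.Injective a)
    {Z : Finset (Fin n)} {i : Fin n} (hi : i ∉ Z) : (Lagrange.nodal Z a).eval (a i) ≠ 0 :=
  Lagrange.eval_nodal_not_at_node fun _ hj h => hi (ha h ▸ hj)

/-- In the extended code, any `r` positions can be separated. -/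
theorem exists_mem_EGRS {n r : ℕ} {a v : Fin n → F} (ha : Function.Injective a)
    (hv : ∀ i, v i ≠ 0) (T : Finset (Fin (n + 1))) (hT : T.card ≤ r) (i : Fin (n + 1))
    (hi : i ∈ T) : ∃ x ∈ EGRS r a v, x i ≠ 0 ∧ ∀ j ∈ T, j ≠ i → x j = 0 := by
  let Z : Finset (Fin n) := Finset.univ.filter fun j => j.castSucc ∈ T.erase i
  have hZT : Z.map Fin.castSuccEmb ⊆ T.erase i := fun j hj => by
    obtain ⟨l, hl, rfl⟩ := Finset.mem_map.1 hj
    simpa [Z] using hl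
  have hcard : (T.erase i).card < r :=
    lt_of_lt_of_le (Finset.card_erase_lt_of_mem hi) hT
  have hZ : Z.card ≤ (T.erase i).card := by
    simpa using Finset.card_le_card hZT
  rcases Fin.eq_castSucc_or_eq_last i with ⟨i, rfl⟩ | rfl
  · refine ⟨_, ⟨Lagrange.nodal Z a, nodal_mem_degreeLT a (by omega), rfl⟩, ?_, fun j hj hji => ?_⟩
    · rw [evalWordExt_castSucc]
      exact mul_ne_zero (hv i) (eval_nodal_ne_zero ha (by simp [Z]))
    · rcases Fin.eq_castSucc_or_eq_last j with ⟨j, rfl⟩ | rfl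
      · rw [evalWordExt_castSucc, Lagrange.eval_nodal_at_node (s := Z) (Finset.mem_filter.2
          ⟨Finset.mem_univ _, Finset.mem_erase.2 ⟨hji, hj⟩⟩),
          mul_zero]
      · rw [evalWordExt_last]
        refine coeff_eq_zero_of_natDegree_lt ?_
        rw [Lagrange.natDegree_nodal]
        -- The last position uses up one element of `T`, so the nodal polynomial has degree below `r
        -- - 1`.
        have : (Z.map Fin.castSuccEmb).card < (T.erase i.castSucc).card := by
          refine Finset.card_lt_card ((Finset.ssubset_iff_of_subset hZT).2
            ⟨Fin.last n, Finset.mem_erase.2 ⟨hji, hj⟩, fun h => ?_⟩)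
          obtain ⟨l, -, hl⟩ := Finset.mem_map.1 h
          exact (Fin.castSucc_lt_last l).ne hl
        rw [Finset.card_map] at this
        omega
  -- Padding to degree exactly `r - 1` makes the coordinate at infinity the leading coefficient 1.
  · refine ⟨_, ⟨Lagrange.nodal Z a * X ^ (r - 1 - Z.card), mem_degreeLT_of_natDegree_lt ?_, rfl⟩,
      ?_, fun j hj hji => ?_⟩
    · refine lt_of_le_of_lt natDegree_mul_le ?_
      rw [Lagrange.natDegree_nodal, natDegree_X_pow]
      omega
    · have : r - 1 = Z.card + (r - 1 - Z.card) := by omega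
      rw [evalWordExt_last]
      nth_rw 2 [this]
      rw [coeff_mul_X_pow, coeff_card_nodal]
      exact one_ne_zero
    · obtain ⟨j, rfl⟩ := (Fin.eq_castSucc_or_eq_last j).resolve_right hji
      rw [evalWordExt_castSucc, eval_mul,
        Lagrange.eval_nodal_at_node (by simp [Z, hj]), zero_mul, mul_zero]

variable [DecidableEq F]

theorem le_minDist_GRS {n r : ℕ} {a v : Fin n → F} (ha : Function.Injective a)
    (hv : ∀ i, v i ≠ 0) : ((n + 1 - r : ℕ) : ℕ∞) ≤ minDist (GRS r a v) := by
  refine le_minDist ?_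
  rintro _ ⟨f, hf, rfl⟩ h0
  have hf0 : f ≠ 0 := fun h => h0 (by rw [h, map_zero])
  have h1 := le_hammingNorm_evalWord ha hv hf0
  have h2 := natDegree_lt_of_mem_degreeLT hf hf0
  omega

theorem le_minDist_EGRS {n r : ℕ} {a v : Fin n → F} (ha : Function.Injective a)
    (hv : ∀ i, v i ≠ 0) : ((n + 1 - (r - 1) : ℕ) : ℕ∞) ≤ minDist (EGRS r a v) := by
  refine le_minDist ?_
  rintro _ ⟨f, hf, rfl⟩ h0
  have hf0 : f ≠ 0 := fun h => h0 (by rw [h, map_zero])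
  have h1 := le_hammingNorm_evalWordExt ha hv hf0 hf
  omega

theorem lt_minDist_dualCode_GRS {n r : ℕ} {a v : Fin n → F} (ha : Function.Injective a)
    (hv : ∀ i, v i ≠ 0) : (r : ℕ∞) < minDist (dualCode (GRS r a v)) := by
  refine lt_minDist_dualCode fun T hT i hi => ⟨_, ⟨Lagrange.nodal (T.erase i) a,
    nodal_mem_degreeLT a ?_, rfl⟩, ?_, fun j hj hji => ?_⟩
  · exact lt_of_lt_of_le (Finset.card_erase_lt_of_mem hi) hT
  · exact mul_ne_zero (hv i) (eval_nodal_ne_zero ha (by simp))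
  · rw [evalWord_apply, Lagrange.eval_nodal_at_node (Finset.mem_erase.2 ⟨hji, hj⟩), mul_zero]

theorem finrank_extHanZhang {n k : ℕ} (hk : 2 ≤ k) (hkn : k ≤ n + 1) {a v : Fin n → F}
    (ha : Function.Injective a) (hv : ∀ i, v i ≠ 0) (hS : ZeroSumFree k (Set.range a)) :
    Module.finrank F (extHanZhang k a v) = k := by
  rw [extHanZhang, finrank_map_of_forall_ne_zero, finrank_twistedPoly (by omega)]
  intro f hf h0
  have h1 := le_hammingNorm_extHanZhang hk ha hv hS h0 hf
  exact hammingNorm_ne_zero_iff.1 (by omega)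

/-- The bound is attained by the nodal polynomial of `k - 2` points: its word also vanishes at
infinity, which makes `k - 1` zeros. -/
theorem minDist_extHanZhang {n k : ℕ} (hk : 2 ≤ k) (hkn : k ≤ n) {a v : Fin n → F}
    (ha : Function.Injective a) (hv : ∀ i, v i ≠ 0) (hS : ZeroSumFree k (Set.range a)) :
    minDist (extHanZhang k a v) = ((n - k + 2 : ℕ) : ℕ∞) := by
  refine le_antisymm ?_ (le_minDist ?_)
  · obtain ⟨Z, -, hZ⟩ := Finset.exists_subset_card_eq (s := (Finset.univ : Finset (Fin n)))
      (n := k - 2) (by simp; omega)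
    have hN : Lagrange.nodal Z a ∈ twistedPoly F k := mem_twistedPoly.2
      ⟨by rw [Lagrange.natDegree_nodal]; omega,
        coeff_eq_zero_of_natDegree_lt (by rw [Lagrange.natDegree_nodal]; omega)⟩
    have h0 := le_hammingNorm_extHanZhang hk ha hv hS (Lagrange.nodal_ne_zero) hN
    refine (minDist_le (Submodule.mem_map_of_mem hN) (hammingNorm_ne_zero_iff.1 (by omega))).trans ?_
    have hk0 : (Lagrange.nodal Z a).coeff k = 0 :=
      coeff_eq_zero_of_natDegree_lt (by rw [Lagrange.natDegree_nodal]; omega)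
    rw [evalWordExt_eq_snoc, hammingNorm_snoc, hk0, if_pos rfl, add_zero, Nat.cast_le]
    have h1 := hammingNorm_add_card_zeros (evalWord a v (Lagrange.nodal Z a))
    have h2 : Z ⊆ Finset.univ.filter fun i => evalWord a v (Lagrange.nodal Z a) i = 0 :=
      fun i hi => by simp [evalWord_apply, Lagrange.eval_nodal_at_node hi]
    have h3 := Finset.card_le_card h2
    omega
  · rintro _ ⟨f, hf, rfl⟩ h0
    have hf0 : f ≠ 0 := fun h => h0 (by rw [h, map_zero])
    have h1 := le_hammingNorm_extHanZhang hk ha hv hS hf0 hf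
    omega

end Codes

/-! ### The pair for `n - k` even -/

theorem vecMulLinear_diagNegLast_castSucc {n : ℕ} (x : Fin (n + 1) → F) (i : Fin n) :
    (diagNegLast F n).vecMulLinear x i.castSucc = x i.castSucc := by
  rw [Matrix.vecMulLinear_apply, diagNegLast, Matrix.vecMul_diagonal, Fin.snoc_castSucc, mul_one]

theorem vecMulLinear_diagNegLast_last {n : ℕ} (x : Fin (n + 1) → F) :
    (diagNegLast F n).vecMulLinear x (Fin.last n) = -x (Fin.last n) := by
  rw [Matrix.vecMulLinear_apply, diagNegLast, Matrix.vecMul_diagonal, Fin.snoc_last, mul_neg_one]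

theorem vecMulLinear_diagNegLast_eq_zero_iff {n : ℕ} (x : Fin (n + 1) → F) (i : Fin (n + 1)) :
    (diagNegLast F n).vecMulLinear x i = 0 ↔ x i = 0 := by
  rcases Fin.eq_castSucc_or_eq_last i with ⟨i, rfl⟩ | rfl
  · rw [vecMulLinear_diagNegLast_castSucc]
  · rw [vecMulLinear_diagNegLast_last, neg_eq_zero]

theorem natDegree_le_of_mem_degreeLT {r : ℕ} {f : F[X]} (hf : f ∈ degreeLT F (r + 1)) :
    f.natDegree ≤ r := by
  rcases eq_or_ne f 0 with rfl | h0
  · simp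
  · exact Nat.lt_succ_iff.1 (natDegree_lt_of_mem_degreeLT hf h0)

theorem isECP_extHanZhang_EGRS [DecidableEq F] {n k ℓ : ℕ} (hℓ : 1 ≤ ℓ) (hn : n = k + 2 * ℓ)
    {a v : Fin n → F} (ha : Function.Injective a) (hv : ∀ i, v i ≠ 0)
    (hd : minDist (extHanZhang k a v) = ((n - k + 2 : ℕ) : ℕ∞)) :
    IsECP ℓ (extHanZhang k a v) (EGRS (ℓ + 1) a 1)
      (codeMulMatrix (EGRS ℓ a (v⁻¹ * uVec a)) (diagNegLast F n)) where
  schur_subset := by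
    rintro _ ⟨_, ⟨g, hg, rfl⟩, _, ⟨_, ⟨h, hh, rfl⟩, rfl⟩, rfl⟩
    rintro _ ⟨f, hf, rfl⟩
    obtain ⟨m, rfl⟩ : ∃ m, ℓ = m + 1 := ⟨ℓ - 1, by omega⟩
    have hf := (mem_twistedPoly.1 hf).1
    have hg := natDegree_le_of_mem_degreeLT hg
    have hh := natDegree_le_of_mem_degreeLT hh
    have hgh : (g * h).natDegree ≤ (m + 1) + m := natDegree_mul_le_of_le hg hh
    have hfgh : (f * (g * h)).natDegree ≤ k + (m + 1 + m) := natDegree_mul_le_of_le hf hgh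
    have hsum := sum_uVec_mul_eval ha (P := f * (g * h)) (by omega)
    -- The degree bounds add up to exactly `n - 1`, so the coefficient splits into the three
    -- coordinates at infinity.
    rw [show n - 1 = k + (m + 1 + m) by omega, coeff_mul_add_eq_of_natDegree_le hf hgh,
      coeff_mul_add_eq_of_natDegree_le hg hh] at hsum
    rw [Fin.sum_univ_castSucc]
    simp only [Pi.mul_apply, vecMulLinear_diagNegLast_castSucc, vecMulLinear_diagNegLast_last,
      evalWordExt_castSucc, evalWordExt_last, Pi.one_apply, Pi.inv_apply, add_tsub_cancel_right]
    rw [mul_neg, mul_neg, ← hsum, ← sub_eq_add_neg, sub_eq_zero]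
    refine Finset.sum_congr rfl fun i _ => ?_
    have := hv i
    rw [eval_mul, eval_mul]
    field_simp
  lt_minDist_dual := by
    refine lt_minDist_dualCode fun T hT i hi => ?_
    obtain ⟨x, hx, hxi, hxj⟩ := exists_mem_EGRS ha (v := v⁻¹ * uVec a)
      (fun i => mul_ne_zero (inv_ne_zero (hv i)) (uVec_ne_zero ha i)) T hT i hi
    exact ⟨_, ⟨x, hx, rfl⟩, fun h0 => hxi ((vecMulLinear_diagNegLast_eq_zero_iff x i).1 h0),
      fun j hj hji => (vecMulLinear_diagNegLast_eq_zero_iff x j).2 (hxj j hj hji)⟩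
  lt_finrank := by
    rw [finrank_EGRS (by omega) ha (v := 1) fun _ => one_ne_zero]
    exact ℓ.lt_succ_self
  lt_minDist_add := by
    rw [hd]
    refine lt_of_lt_of_le ?_ (add_le_add_left (le_minDist_EGRS ha fun _ => one_ne_zero) _)
    norm_cast
    omega

/-! ### The pair for `n - k` odd: moving infinity to 0 -/

theorem aPrime_injective {n : ℕ} {a : Fin n → F} (ha : Function.Injective a) {γ : F}
    (hγ : γ ∉ Set.range a) : Function.Injective (aPrime a γ) := by
  have h0 : ∀ i, a i - γ ≠ 0 := fun i => sub_ne_zero.2 fun h => hγ ⟨i, h⟩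
  refine Fin.snoc_injective_iff.2 ⟨fun i j hij => ha ?_, ?_⟩
  · simpa using hij
  · rintro ⟨i, hi⟩
    exact inv_ne_zero (h0 i) hi

theorem uPrime_eq_uVec {n : ℕ} {a : Fin n → F} {γ : F} (hγ : γ ∉ Set.range a) :
    uPrime a γ = uVec (aPrime a γ) := by
  have h0 : ∀ i, a i - γ ≠ 0 := fun i => sub_ne_zero.2 fun h => hγ ⟨i, h⟩
  have hi1 : ∀ i, aPrime a γ (Fin.castSucc i) = (a i - γ)⁻¹ := fun i => Fin.snoc_castSucc ..
  have hlast : aPrime a γ (Fin.last n) = 0 := Fin.snoc_last ..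
  have huniv : (Finset.univ : Finset (Fin (n + 1)))
      = insert (Fin.last n) (Finset.univ.map Fin.castSuccEmb) := by
    rw [Fin.univ_castSuccEmb, Finset.cons_eq_insert]
  ext i
  rcases Fin.eq_castSucc_or_eq_last i with ⟨i, rfl⟩ | rfl
  · have hset : (Finset.univ : Finset (Fin (n + 1))).erase i.castSucc
        = insert (Fin.last n) ((Finset.univ.erase i).map Fin.castSuccEmb) := by
      rw [Finset.map_erase, huniv, Finset.erase_insert_of_ne (Fin.castSucc_lt_last i).ne']
      rfl
    rw [uPrime, Fin.snoc_castSucc, uVec, hset, Finset.prod_insert (by simp), Finset.prod_map]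
    simp only [Fin.castSuccEmb_apply, hi1, hlast, sub_zero, inv_inv]
    -- One factor comes from the point 0; the other `n - 1` clear denominators in the differences of
    -- inverses.
    have hn : (a i - γ) ^ n = (a i - γ) * ∏ j ∈ Finset.univ.erase i, (a i - γ) := by
      rw [Finset.prod_const, ← pow_succ', Finset.card_erase_of_mem (Finset.mem_univ i),
        Finset.card_fin, Nat.sub_add_cancel i.pos]
    rw [hn, mul_assoc, ← Finset.prod_mul_distrib]
    refine congrArg _ (Finset.prod_congr rfl fun j hj => ?_)
    have h1 := h0 i
    have h2 := h0 j
    rw [inv_sub_inv h1 h2, inv_div, sub_sub_sub_cancel_right]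
    ring
  · have hset : (Finset.univ : Finset (Fin (n + 1))).erase (Fin.last n)
        = Finset.univ.map Fin.castSuccEmb := by
      rw [huniv, Finset.erase_insert (by simp)]
    rw [uPrime, Fin.snoc_last, uVec, hset, Finset.prod_map]
    simp only [Fin.castSuccEmb_apply, hi1, hlast, zero_sub, inv_neg, inv_inv]
    rw [Finset.prod_neg, Finset.card_fin]

/-- The reflected polynomial is `t^k f(γ + 1/t)`. This is the source of the factors `(a_i - γ)^k` in
`v'`. -/
theorem eval_reflect_comp {k : ℕ} {f : F[X]} (hf : f.natDegree ≤ k) {x γ : F} (hx : x - γ ≠ 0) :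
    ((f.comp (X + C γ)).reflect k).eval (x - γ)⁻¹ * (x - γ) ^ k = f.eval x := by
  let _ := invertibleOfNonzero hx
  have h := eval₂_reflect_mul_pow (RingHom.id F) (x - γ) k (f.comp (X + C γ))
    (by rwa [natDegree_comp, natDegree_X_add_C, mul_one])
  rw [invOf_eq_inv] at h
  simpa [eval_comp] using h

theorem coeff_comp_X_add_C {k : ℕ} {f : F[X]} (hf : f.natDegree ≤ k) (γ : F) :
    (f.comp (X + C γ)).coeff k = f.coeff k := by
  rcases hf.lt_or_eq with hf | rfl
  · rw [coeff_eq_zero_of_natDegree_lt hf, coeff_eq_zero_of_natDegree_lt]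
    rwa [natDegree_comp, natDegree_X_add_C, mul_one]
  · have h := leadingCoeff_comp (p := f) (q := X + C γ) (by rw [natDegree_X_add_C]; exact one_ne_zero)
    rw [leadingCoeff, natDegree_comp, natDegree_X_add_C, mul_one, leadingCoeff_X_add_C, one_pow,
      mul_one] at h
    exact h

theorem isECP_extHanZhang_GRS [DecidableEq F] {n k ℓ : ℕ} (hℓ : 2 ≤ ℓ) (hn : n + 1 = k + 2 * ℓ)
    {a v : Fin n → F} (ha : Function.Injective a) (hv : ∀ i, v i ≠ 0)
    (hd : minDist (extHanZhang k a v) = ((n - k + 2 : ℕ) : ℕ∞)) {γ : F}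
    (hγ : γ ∉ Set.range a) :
    IsECP (ℓ - 1) (extHanZhang k a v) (GRS ℓ (aPrime a γ) 1)
      (GRS (ℓ - 1) (aPrime a γ) ((vPrime k a v γ)⁻¹ * uPrime a γ)) := by
  have h0 : ∀ i, a i - γ ≠ 0 := fun i => sub_ne_zero.2 fun h => hγ ⟨i, h⟩
  have ha' := aPrime_injective ha hγ
  have hi1 : ∀ i, aPrime a γ (Fin.castSucc i) = (a i - γ)⁻¹ := fun i => Fin.snoc_castSucc ..
  have hlast : aPrime a γ (Fin.last n) = 0 := Fin.snoc_last ..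
  have hvi : ∀ i, vPrime k a v γ (Fin.castSucc i) = v i * (a i - γ) ^ k :=
    fun i => Fin.snoc_castSucc ..
  have hvlast : vPrime k a v γ (Fin.last n) = 1 := Fin.snoc_last ..
  have hv' : ∀ i, vPrime k a v γ i ≠ 0 := fun i => by
    rcases Fin.eq_castSucc_or_eq_last i with ⟨i, rfl⟩ | rfl
    · rw [hvi]
      exact mul_ne_zero (hv i) (pow_ne_zero _ (h0 i))
    · rw [hvlast]
      exact one_ne_zero
  rw [uPrime_eq_uVec hγ]
  refine ⟨⟨?_, ?_, ?_⟩, ?_⟩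
  · rintro _ ⟨_, ⟨g, hg, rfl⟩, _, ⟨h, hh, rfl⟩, rfl⟩
    rintro _ ⟨f, hf, rfl⟩
    obtain ⟨m, rfl⟩ : ∃ m, ℓ = m + 2 := ⟨ℓ - 2, by omega⟩
    have hf := (mem_twistedPoly.1 hf).1
    have hg := natDegree_le_of_mem_degreeLT hg
    have hh := natDegree_le_of_mem_degreeLT hh
    set p := (f.comp (X + C γ)).reflect k with hp
    have hpk : p.natDegree ≤ k := by
      refine natDegree_reflect_le.trans (max_le le_rfl ?_)
      rwa [natDegree_comp, natDegree_X_add_C, mul_one]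
    have hdeg : (p * (g * h)).natDegree ≤ k + (m + 1 + m) :=
      natDegree_mul_le_of_le hpk (natDegree_mul_le_of_le hg hh)
    have hsum := sum_uVec_mul_eval ha' (P := p * (g * h)) (by omega)
    -- On `n + 1` points the identity reads off the coefficient of `x^n`, while the degree is at
    -- most `n - 2`.
    rw [coeff_eq_zero_of_natDegree_lt (by omega)] at hsum
    rw [← hsum]
    refine Finset.sum_congr rfl fun i _ => ?_
    simp only [Pi.mul_apply, evalWord_apply, Pi.one_apply, Pi.inv_apply, eval_mul, one_mul]
    rcases Fin.eq_castSucc_or_eq_last i with ⟨i, rfl⟩ | rfl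
    · have h1 := hv i
      have h2 := pow_ne_zero k (h0 i)
      rw [evalWordExt_castSucc, hvi, ← eval_reflect_comp hf (h0 i), ← hp, hi1]
      field_simp
    · have hp0 : p.eval 0 = f.coeff k := by
        rw [← coeff_zero_eq_eval_zero, hp, coeff_reflect, revAt_zero, coeff_comp_X_add_C hf]
      rw [evalWordExt_last, hvlast, hlast, hp0]
      ring
  · exact lt_minDist_dualCode_GRS ha' fun i =>
      mul_ne_zero (inv_ne_zero (hv' i)) (uVec_ne_zero ha' i)
  · rw [finrank_GRS (by omega) ha' (v := 1) fun _ => one_ne_zero]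
    omega
  · rw [hd]
    refine lt_of_lt_of_le ?_ (add_le_add_left (le_minDist_GRS ha' fun _ => one_ne_zero) _)
    norm_cast
    omega

/-! ### Zero-sum subsets and the existence of `γ` -/

/-- Over a field of odd characteristic there are zero-sum sets of each admissible even size that
avoid zero. -/
theorem exists_finset_sum_eq_zero_of_two_ne_zero [Finite F] (h2 : (2 : F) ≠ 0) (m : ℕ)
    (hm : 2 * m < Nat.card F) :
    ∃ T : Finset F, T.card = 2 * m ∧ 0 ∉ T ∧ (∀ x ∈ T, -x ∈ T) ∧ ∑ x ∈ T, x = 0 := by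
  classical
  cases nonempty_fintype F
  rw [Nat.card_eq_fintype_card] at hm
  induction m with
  | zero => exact ⟨∅, by simp⟩
  | succ m ih =>
    obtain ⟨T, hT, h0, hneg, hsum⟩ := ih (by omega)
    obtain ⟨x, hx⟩ : ∃ x, x ∉ insert 0 T := by
      by_contra! h
      have := Finset.card_le_card (fun x _ => h x : Finset.univ ⊆ insert 0 T)
      rw [Finset.card_univ, Finset.card_insert_of_notMem h0] at this
      omega
    obtain ⟨hx0, hxT⟩ : x ≠ 0 ∧ x ∉ T := by simpa using hx
    have hnT : -x ∉ T := fun h => hxT (by simpa using hneg _ h)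
    have hxx : x ≠ -x := fun h => by
      have : 2 * x = 0 := by linear_combination h
      exact (mul_ne_zero h2 hx0) this
    have hx' : x ∉ insert (-x) T := by simp [hxx, hxT]
    refine ⟨insert x (insert (-x) T), ?_, ?_, ?_, ?_⟩
    · rw [Finset.card_insert_of_notMem hx', Finset.card_insert_of_notMem hnT, hT]
      ring
    · simp [h0, hx0, hx0.symm]
    · intro y hy
      rcases Finset.mem_insert.1 hy with rfl | hy
      · simp
      · rcases Finset.mem_insert.1 hy with rfl | hy
        · simp
        · simp [hneg y hy]
    · rw [Finset.sum_insert hx', Finset.sum_insert hnT, hsum]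
      ring

/-- A finite field contains `k` distinct elements with sum zero, unless both its characteristic
is two and `k` is even. -/
theorem exists_finset_card_eq_sum_eq_zero [Finite F] {k : ℕ} (hk : k ≤ Nat.card F)
    (hodd : (2 : F) = 0 → Odd k) : ∃ T : Finset F, T.card = k ∧ ∑ x ∈ T, x = 0 := by
  classical
  cases nonempty_fintype F
  by_cases h2 : (2 : F) = 0
  · obtain ⟨T, -, hT⟩ := Finset.exists_subset_card_eq (s := (Finset.univ : Finset F)) (n := k)
      (by rwa [Finset.card_univ, ← Nat.card_eq_fintype_card])
    -- Translating `T` by its own sum `s` gives the sum `(k + 1) s`, which is 0 because `k + 1` is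
    -- even and `2 = 0`.
    refine ⟨T.map (addRightEmbedding (∑ x ∈ T, x)), by rw [Finset.card_map, hT], ?_⟩
    obtain ⟨m, rfl⟩ := hodd h2
    rw [Finset.sum_map]
    simp only [addRightEmbedding_apply]
    rw [Finset.sum_add_distrib, Finset.sum_const, hT, nsmul_eq_mul]
    push_cast
    linear_combination (1 + m : F) * (∑ x ∈ T, x) * h2
  · rcases Nat.even_or_odd' k with ⟨m, rfl | rfl⟩
    · rcases hk.lt_or_eq with hk | hk
      · obtain ⟨T, hT, -, -, hsum⟩ := exists_finset_sum_eq_zero_of_two_ne_zero h2 m hk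
        exact ⟨T, hT, hsum⟩
      · exfalso
        have hc : ringChar F ≠ 2 := fun h => h2 (by
          have := CharP.cast_eq_zero F (ringChar F)
          rwa [h, Nat.cast_ofNat] at this)
        have := FiniteField.odd_card_of_char_ne_two hc
        rw [← Nat.card_eq_fintype_card] at this
        omega
    · obtain ⟨T, hT, h0, -, hsum⟩ := exists_finset_sum_eq_zero_of_two_ne_zero h2 m (by omega)
      exact ⟨insert 0 T, by rw [Finset.card_insert_of_notMem h0, hT],
        by rw [Finset.sum_insert h0, hsum, add_zero]⟩

theorem exists_notMem_range_of_zeroSumFree [Finite F] {n k : ℕ} (hkn : k + 2 ≤ n)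
    {a : Fin n → F} (ha : Function.Injective a) (hS : ZeroSumFree k (Set.range a))
    (hodd : Odd (n - k)) : ∃ γ : F, γ ∉ Set.range a := by
  by_contra! h
  have hcard : Nat.card F = n := by
    rw [← Nat.card_congr (Equiv.ofBijective a ⟨ha, h⟩), Nat.card_fin]
  obtain ⟨T, hT, hsum⟩ := exists_finset_card_eq_sum_eq_zero (F := F) (k := k) (by omega)
    fun h2 => by
      cases nonempty_fintype F
      have hc : ringChar F = 2 := by
        have hdvd := (ringChar.spec F 2).1 (by exact_mod_cast h2)
        exact ((Nat.dvd_prime Nat.prime_two).1 hdvd).resolve_left (CharP.ringChar_ne_one)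
      have := FiniteField.even_card_of_char_two hc
      rw [← Nat.card_eq_fintype_card, hcard] at this
      obtain ⟨m, hm⟩ := hodd
      exact Nat.odd_iff.2 (by omega)
  exact hS T (fun x _ => h x) hT hsum

/-! ### Nonexistence of an error-locating pair for `n - k` odd -/

/-- A word of the dual of the extended Han-Zhang code vanishing at `n - k` of the first `n`
positions is a multiple of an explicit word. -/
theorem exists_eq_of_mem_dualCode_extHanZhang {n k : ℕ} (hk : 2 ≤ k) (hkn : k + 1 ≤ n)
    {a v : Fin n → F} (ha : Function.Injective a) (hv : ∀ i, v i ≠ 0) {y : Fin (n + 1) → F}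
    (hy : y ∈ dualCode (extHanZhang k a v)) {T : Finset (Fin n)} (hT : T.card = n - k)
    (hyT : ∀ i ∈ T, y i.castSucc = 0) :
    ∃ c : F, (∀ i, y i.castSucc = c * (uVec a i / v i * (Lagrange.nodal T a).eval (a i))) ∧
      y (Fin.last n) = -(c * (∑ i, a i - ∑ i ∈ T, a i)) := by
  obtain ⟨g, hg, hgy⟩ : ∃ g : F[X], g.natDegree < n ∧
      ∀ i, y i.castSucc = uVec a i / v i * g.eval (a i) := by
    refine ⟨Lagrange.interpolate Finset.univ a fun i => y i.castSucc * v i / uVec a i, ?_,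
      fun i => ?_⟩
    · have := Lagrange.degree_interpolate_lt (s := Finset.univ)
        (fun i => y i.castSucc * v i / uVec a i) (ha.injOn (s := _))
      rw [Finset.card_fin] at this
      rcases eq_or_ne (Lagrange.interpolate Finset.univ a
        fun i => y i.castSucc * v i / uVec a i) 0 with h0 | h0
      · rw [h0, natDegree_zero]
        omega
      · exact (natDegree_lt_iff_degree_lt h0).2 this
    · rw [Lagrange.eval_interpolate_at_node _ ha.injOn (Finset.mem_univ i)]
      have h1 := hv i
      have h2 := uVec_ne_zero ha i
      field_simp
  have horth : ∀ f ∈ twistedPoly F k,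
      ∑ i, uVec a i * (f * g).eval (a i) + f.coeff k * y (Fin.last n) = 0 := fun f hf => by
    have h := hy _ (Submodule.mem_map_of_mem hf)
    rw [Fin.sum_univ_castSucc, evalWordExt_last] at h
    rw [← h]
    congr 1
    refine Finset.sum_congr rfl fun i _ => ?_
    have h1 := hv i
    rw [evalWordExt_castSucc, hgy, eval_mul]
    field_simp
  have hgk : g.natDegree ≤ n - k := by
    by_contra! hlt
    -- The exponent is at most `k - 2`, and multiplying by `g` gives degree `n - 1`, so this pairing
    -- isolates the leading coefficient of `g`.
    have hmem : (X ^ (n - 1 - g.natDegree) : F[X]) ∈ twistedPoly F k := mem_twistedPoly.2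
      ⟨by rw [natDegree_X_pow]; omega, by rw [coeff_X_pow, if_neg (by omega)]⟩
    have h := horth _ hmem
    rw [coeff_X_pow, if_neg (by omega), zero_mul, add_zero, sum_uVec_mul_eval ha] at h
    · rw [show n - 1 = g.natDegree + (n - 1 - g.natDegree) by omega, Nat.add_sub_cancel_left,
        coeff_X_pow_mul, coeff_natDegree, leadingCoeff_eq_zero] at h
      rw [h, natDegree_zero] at hlt
      omega
    · refine lt_of_le_of_lt natDegree_mul_le ?_
      rw [natDegree_X_pow]
      omega
  have hgT := eq_C_coeff_mul_nodal ha (hgk.trans hT.ge) fun i hi => by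
    have h := hyT i hi
    rw [hgy] at h
    exact (mul_eq_zero.1 h).resolve_left (div_ne_zero (uVec_ne_zero ha i) (hv i))
  set c := g.coeff T.card
  refine ⟨c, fun i => ?_, ?_⟩
  · rw [hgy, hgT, eval_mul, eval_C]
    ring
  · have hmem : (X ^ k : F[X]) ∈ twistedPoly F k := mem_twistedPoly.2
      ⟨by rw [natDegree_X_pow], by rw [coeff_X_pow, if_neg (by omega)]⟩
    have h := horth _ hmem
    rw [sum_uVec_mul_eval_of_natDegree_le (by omega) ha, coeff_X_pow, if_pos rfl, one_mul] at h
    · have e1 : n - 1 = (T.card - 1) + k := by omega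
      have e2 : n = T.card + k := by omega
      have hn1 : (X ^ k * g).coeff (n - 1) = -(c * ∑ i ∈ T, a i) := by
        rw [e1, coeff_X_pow_mul, hgT, coeff_C_mul, Lagrange.nodal_eq,
          prod_X_sub_C_coeff_card_pred T a (by omega), mul_neg]
      have hn2 : (X ^ k * g).coeff n = c := by
        conv_lhs => rw [e2]
        rw [coeff_X_pow_mul]
      rw [hn1, hn2] at h
      linear_combination h
    · refine natDegree_mul_le.trans ?_
      rw [natDegree_X_pow]
      omega

theorem exists_ne_zero_mem_of_card_lt_finrank {N : ℕ} {A : Submodule F (Fin N → F)}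
    {I : Finset (Fin N)} (hI : I.card < Module.finrank F A) :
    ∃ z ∈ A, z ≠ 0 ∧ ∀ i ∈ I, z i = 0 := by
  let φ : A →ₗ[F] (I → F) := (LinearMap.funLeft F F (Subtype.val : I → Fin N)).comp A.subtype
  have hker : LinearMap.ker φ ≠ ⊥ := LinearMap.ker_ne_bot_of_finrank_lt (by simpa using hI)
  obtain ⟨z, hz, h0⟩ := (Submodule.ne_bot_iff _).1 hker
  refine ⟨z.1, z.2, by simpa using h0, fun i hi => ?_⟩
  exact congrFun (LinearMap.mem_ker.1 hz) ⟨i, hi⟩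

variable [DecidableEq F]

theorem IsELP.mul_mem {N ℓ : ℕ} {C A B : Submodule F (Fin N → F)} (h : IsELP ℓ C A B)
    {x y : Fin N → F} (hx : x ∈ A) (hy : y ∈ B) : x * y ∈ dualCode C :=
  h.schur_subset ⟨x, hx, y, hy, rfl⟩

theorem IsELP.exists_eq_one {n ℓ : ℕ} {C A B : Submodule F (Fin (n + 1) → F)}
    (h : IsELP ℓ C A B) {J : Finset (Fin n)} (hJ : J.card < ℓ) {i : Fin (n + 1)}
    (hi : i ∉ J.map Fin.castSuccEmb) : ∃ b ∈ B, b i = 1 ∧ ∀ j ∈ J, b j.castSucc = 0 := by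
  obtain ⟨b, hb, hbi, hbJ⟩ := exists_mem_eq_one_of_lt_minDist_dualCode h.lt_minDist_dual
    (J := J.map Fin.castSuccEmb) (by rwa [Finset.card_map]) hi
  exact ⟨b, hb, hbi, fun j hj => hbJ _ (Finset.mem_map_of_mem _ hj)⟩

/-- The first code of an error-locating pair contains a word vanishing at any `ℓ` given affine
positions, but not at another given one. -/
theorem IsELP.exists_ne_zero {n k ℓ : ℕ} (hk : 3 ≤ k) (hℓ : 1 ≤ ℓ) (hn : n + 1 = k + 2 * ℓ)
    {a v : Fin n → F} (ha : Function.Injective a) (hv : ∀ i, v i ≠ 0)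
    {A B : Submodule F (Fin (n + 1) → F)} (h : IsELP ℓ (extHanZhang k a v) A B)
    {I : Finset (Fin n)} (hI : I.card = ℓ) {i : Fin n} (hi : i ∉ I) :
    ∃ z ∈ A, z i.castSucc ≠ 0 ∧ ∀ j ∈ I, z j.castSucc = 0 := by
  obtain ⟨z, hz, hz0, hzI⟩ := exists_ne_zero_mem_of_card_lt_finrank
    (A := A) (I := I.map Fin.castSuccEmb) (by rw [Finset.card_map, hI]; exact h.lt_finrank)
  have hzI : ∀ j ∈ I, z j.castSucc = 0 := fun j hj => hzI _ (Finset.mem_map_of_mem _ hj)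
  refine ⟨z, hz, fun hzi => ?_, hzI⟩
  obtain ⟨p, hp⟩ : ∃ p, z p ≠ 0 := by
    by_contra! h'
    exact hz0 (funext h')
  let Q : Finset (Fin n) := insert i I ∪ Finset.univ.filter fun q => q.castSucc = p
  have hQ : Q.card ≤ ℓ + 2 := by
    have h1 : (Finset.univ.filter fun q : Fin n => q.castSucc = p).card ≤ 1 :=
      Finset.card_le_one.2 fun x hx y hy => Fin.castSucc_injective n (by simp_all)
    have h2 := Finset.card_union_le (insert i I) (Finset.univ.filter fun q => q.castSucc = p)
    rw [Finset.card_insert_of_notMem hi] at h2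
    change (insert i I ∪ Finset.univ.filter fun q : Fin n => q.castSucc = p).card ≤ ℓ + 2
    omega
  obtain ⟨J, hJQ, hJ⟩ := Finset.exists_subset_card_eq (s := Qᶜ) (n := ℓ - 1) (by
    rw [Finset.card_compl, Fintype.card_fin]
    omega)
  have hJQ' : ∀ j ∈ J, j ≠ i ∧ j ∉ I ∧ j.castSucc ≠ p := fun j hj => by
    have := hJQ hj
    simpa [Q, and_assoc] using this
  obtain ⟨b, hb, hbp, hbJ⟩ := h.exists_eq_one (J := J) (i := p) (by omega) fun hmem => by
    obtain ⟨j, hj, hjp⟩ := Finset.mem_map.1 hmem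
    exact (hJQ' j hj).2.2 hjp
  have hdisj : Disjoint I J := Finset.disjoint_right.2 fun j hj => (hJQ' j hj).2.1
  obtain ⟨c, hc, hcl⟩ := exists_eq_of_mem_dualCode_extHanZhang (by omega) (by omega) ha hv
    (h.mul_mem hz hb) (T := I ∪ J) (by rw [Finset.card_union_of_disjoint hdisj]; omega) (by
      intro j hj
      rcases Finset.mem_union.1 hj with hj | hj
      · rw [Pi.mul_apply, hzI j hj, zero_mul]
      · rw [Pi.mul_apply, hbJ j hj, mul_zero])
  have hiT : i ∉ I ∪ J := fun hmem => by
    rcases Finset.mem_union.1 hmem with hmem | hmem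
    · exact hi hmem
    · exact (hJQ' i hmem).1 rfl
  -- The extra zero at `i` kills the scalar, although the product is nonzero at `p`.
  have hc0 : c = 0 := by
    have := hc i
    rw [Pi.mul_apply, hzi, zero_mul, eq_comm, mul_eq_zero] at this
    exact this.resolve_right (mul_ne_zero (div_ne_zero (uVec_ne_zero ha i) (hv i))
      (eval_nodal_ne_zero ha hiT))
  have hzb : (z * b) p = 0 := by
    rcases Fin.eq_castSucc_or_eq_last p with ⟨p, rfl⟩ | rfl
    · rw [hc, hc0, zero_mul]
    · rw [hcl, hc0, zero_mul, neg_zero]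
  rw [Pi.mul_apply, hbp, mul_one] at hzb
  exact hp hzb

/-- The contradiction needs no distance condition on `A`, so even error location is impossible. -/
theorem not_isELP_extHanZhang {n k ℓ : ℕ} (hk : 3 ≤ k) (hℓ : 2 ≤ ℓ) (hn : n + 1 = k + 2 * ℓ)
    {a v : Fin n → F} (ha : Function.Injective a) (hv : ∀ i, v i ≠ 0)
    {A B : Submodule F (Fin (n + 1) → F)} : ¬ IsELP ℓ (extHanZhang k a v) A B := by
  intro h
  -- Points 0 and 1 are the varying zeros for `A`, points 2 and 3 those for `B`, and point 4 is
  -- where scalars are compared. With `K` and `L` this takes `2ℓ + 2` positions, available because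
  -- `k ≥ 3`.
  obtain ⟨e, he⟩ : ∃ e : Fin 5 → Fin n, Function.Injective e :=
    ⟨Fin.castLE (by omega), Fin.castLE_injective _⟩
  obtain ⟨K, hKe, hK⟩ := Finset.exists_subset_card_eq (s := (Finset.univ.image e)ᶜ)
    (n := ℓ - 1) (by
      rw [Finset.card_compl, Finset.card_image_of_injective _ he, Fintype.card_fin,
        Finset.card_fin]
      omega)
  obtain ⟨L, hLe, hL⟩ := Finset.exists_subset_card_eq (s := (Finset.univ.image e ∪ K)ᶜ)
    (n := ℓ - 2) (by
      have := Finset.card_union_le (Finset.univ.image e) K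
      rw [Finset.card_image_of_injective _ he, Finset.card_fin] at this
      rw [Finset.card_compl, Fintype.card_fin]
      omega)
  have heK : ∀ s, e s ∉ K := fun s hs => by simpa using hKe hs
  have heL : ∀ s, e s ∉ L := fun s hs => by simpa using hLe hs
  have hKL : Disjoint K L := Finset.disjoint_right.2 fun j hj hjK => by
    have := hLe hj
    simp [hjK] at this
  have hnotK : ∀ s t, s ≠ t → e t ∉ insert (e s) K := fun s t hst => by
    simp [heK, he.ne hst.symm]
  have hnotL : ∀ s t, s ≠ t → e t ∉ insert (e s) L := fun s t hst => by
    simp [heL, he.ne hst.symm]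
  have hz : ∀ s, s ≠ 4 → ∃ z ∈ A, z (e 4).castSucc ≠ 0 ∧ ∀ j ∈ insert (e s) K, z j.castSucc = 0 :=
    fun s hs => h.exists_ne_zero hk (by omega) hn ha hv
      (by rw [Finset.card_insert_of_notMem (heK s)]; omega) (hnotK s 4 hs)
  have hb : ∀ s, s ≠ 4 → ∃ b ∈ B, b (e 4).castSucc = 1 ∧ ∀ j ∈ insert (e s) L, b j.castSucc = 0 :=
    fun s hs => h.exists_eq_one (by rw [Finset.card_insert_of_notMem (heL s)]; omega)
      (fun hmem => hnotL s 4 hs (by simpa using hmem))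
  have hword : ∀ s t, s ≠ t → s ≠ 4 → t ≠ 4 → ∀ z ∈ A, z (e 4).castSucc ≠ 0 →
      (∀ j ∈ insert (e s) K, z j.castSucc = 0) → ∀ b ∈ B, b (e 4).castSucc = 1 →
      (∀ j ∈ insert (e t) L, b j.castSucc = 0) →
      ∃ c : F, c ≠ 0 ∧ z (e 4).castSucc = c * (uVec a (e 4) / v (e 4) *
        ((a (e 4) - a (e s)) * (a (e 4) - a (e t)) * (Lagrange.nodal (K ∪ L) a).eval (a (e 4)))) ∧
      z (Fin.last n) * b (Fin.last n)
        = -(c * ((∑ i, a i - ∑ i ∈ K ∪ L, a i) - a (e s) - a (e t))) := by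
    intro s t hst hs ht z hzA hz4 hzK b hbB hb4 hbL
    have hu : insert (e s) K ∪ insert (e t) L = insert (e s) (insert (e t) (K ∪ L)) := by
      ext
      simp only [Finset.mem_union, Finset.mem_insert]
      tauto
    have ht' : e t ∉ K ∪ L := by simp [heK, heL]
    have hs' : e s ∉ insert (e t) (K ∪ L) := by simp [heK, heL, he.ne hst]
    obtain ⟨c, hc, hcl⟩ := exists_eq_of_mem_dualCode_extHanZhang (by omega) (by omega) ha hv
      (h.mul_mem hzA hbB) (T := insert (e s) K ∪ insert (e t) L) (by
        rw [hu, Finset.card_insert_of_notMem hs', Finset.card_insert_of_notMem ht',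
          Finset.card_union_of_disjoint hKL]
        omega) (by
        intro j hj
        rcases Finset.mem_union.1 hj with hj | hj
        · rw [Pi.mul_apply, hzK j hj, zero_mul]
        · rw [Pi.mul_apply, hbL j hj, mul_zero])
    have hc4 := hc (e 4)
    rw [Pi.mul_apply, hb4, mul_one] at hc4
    refine ⟨c, fun hc0 => hz4 (by rw [hc4, hc0, zero_mul]), ?_, ?_⟩
    · rw [hc4, hu, Lagrange.nodal_insert_eq_nodal hs', Lagrange.nodal_insert_eq_nodal ht']
      simp only [eval_mul, eval_sub, eval_X, eval_C]
      ring
    · rw [← Pi.mul_apply, hcl, hu, Finset.sum_insert hs', Finset.sum_insert ht']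
      ring
  obtain ⟨z₀, hz₀A, hz₀4, hz₀⟩ := hz 0 (by decide)
  obtain ⟨z₁, hz₁A, hz₁4, hz₁⟩ := hz 1 (by decide)
  obtain ⟨b₂, hb₂B, hb₂4, hb₂⟩ := hb 2 (by decide)
  obtain ⟨b₃, hb₃B, hb₃4, hb₃⟩ := hb 3 (by decide)
  obtain ⟨c02, h02, e02, l02⟩ := hword 0 2 (by decide) (by decide) (by decide)
    z₀ hz₀A hz₀4 hz₀ b₂ hb₂B hb₂4 hb₂
  obtain ⟨c03, h03, e03, l03⟩ := hword 0 3 (by decide) (by decide) (by decide)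
    z₀ hz₀A hz₀4 hz₀ b₃ hb₃B hb₃4 hb₃
  obtain ⟨c12, h12, e12, l12⟩ := hword 1 2 (by decide) (by decide) (by decide)
    z₁ hz₁A hz₁4 hz₁ b₂ hb₂B hb₂4 hb₂
  obtain ⟨c13, h13, e13, l13⟩ := hword 1 3 (by decide) (by decide) (by decide)
    z₁ hz₁A hz₁4 hz₁ b₃ hb₃B hb₃4 hb₃
  set σ := ∑ i, a i - ∑ i ∈ K ∪ L, a i
  set w := uVec a (e 4) / v (e 4)
  set P := (Lagrange.nodal (K ∪ L) a).eval (a (e 4))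
  have hw : w ≠ 0 := div_ne_zero (uVec_ne_zero ha _) (hv _)
  have hP : P ≠ 0 := eval_nodal_ne_zero ha (by simp [heK, heL])
  have hsub : ∀ s t, s ≠ t → a (e s) - a (e t) ≠ 0 := fun s t hst =>
    sub_ne_zero.2 (ha.ne (he.ne hst))
  have h40 := hsub 4 0 (by decide)
  have h41 := hsub 4 1 (by decide)
  have h42 := hsub 4 2 (by decide)
  have h43 := hsub 4 3 (by decide)
  -- At point 4 both sides come from `z₀ z₁`, as `b₂` and `b₃` equal 1 there, and the geometric
  -- factors agree.
  have hcc : c02 * c13 = c12 * c03 := by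
    have hne : w * w * P * P * (a (e 4) - a (e 0)) * (a (e 4) - a (e 1)) * (a (e 4) - a (e 2))
        * (a (e 4) - a (e 3)) ≠ 0 := by
      simp only [ne_eq, mul_eq_zero, hw, hP, h40, h41, h42, h43, or_self, not_false_eq_true]
    refine mul_left_cancel₀ hne ?_
    have h1 : z₀ (e 4).castSucc * z₁ (e 4).castSucc = z₁ (e 4).castSucc * z₀ (e 4).castSucc :=
      mul_comm _ _
    have h2 := congrArg₂ (· * ·) e02 e13
    have h3 := congrArg₂ (· * ·) e12 e03
    linear_combination h1 - h2 + h3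
  have hll : (c02 * (σ - a (e 0) - a (e 2))) * (c13 * (σ - a (e 1) - a (e 3)))
      = (c12 * (σ - a (e 1) - a (e 2))) * (c03 * (σ - a (e 0) - a (e 3))) := by
    have h2 := congrArg₂ (· * ·) l02 l13
    have h3 := congrArg₂ (· * ·) l12 l03
    linear_combination h3 - h2
  have hfin : c12 * c03 * ((a (e 0) - a (e 1)) * (a (e 2) - a (e 3))) = 0 := by
    linear_combination (σ - a (e 0) - a (e 2)) * (σ - a (e 1) - a (e 3)) * hcc - hll
  exact mul_ne_zero (mul_ne_zero h12 h03)
    (mul_ne_zero (hsub 0 1 (by decide)) (hsub 2 3 (by decide))) hfin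

end CodingECP

/-! ### The main theorem -/

theorem mainTheorem1 {F : Type*} [Field F] [Finite F] [DecidableEq F]
    (n k : ℕ) (hk : 3 ≤ k) (hkn : k + 2 ≤ n)
    (a v : Fin n → F) (ha : Function.Injective a) (hv : ∀ i, v i ≠ 0)
    (ℓ : ℕ) (hℓ : ℓ = ((CodingECP.minDist (CodingECP.extHanZhang k a v)).toNat - 1) / 2)
    (hS : CodingECP.ZeroSumFree k (Set.range a)) :
    (Module.finrank F (CodingECP.extHanZhang k a v) = k ∧
      CodingECP.minDist (CodingECP.extHanZhang k a v) = ((n - k + 2 : ℕ) : ℕ∞)) ∧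
    (Odd (n - k) →
      (¬ ∃ A B : Submodule F (Fin (n + 1) → F),
        CodingECP.IsECP ℓ (CodingECP.extHanZhang k a v) A B) ∧
      (∃ γ : F, γ ∉ Set.range a) ∧
      ∀ γ : F, γ ∉ Set.range a →
        CodingECP.IsECP (ℓ - 1) (CodingECP.extHanZhang k a v)
          (CodingECP.GRS ℓ (CodingECP.aPrime a γ) 1)
          (CodingECP.GRS (ℓ - 1) (CodingECP.aPrime a γ)
            ((CodingECP.vPrime k a v γ)⁻¹ * CodingECP.uPrime a γ))) ∧
    (Even (n - k) →
      CodingECP.IsECP ℓ (CodingECP.extHanZhang k a v)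
        (CodingECP.EGRS (ℓ + 1) a 1)
        (CodingECP.codeMulMatrix (CodingECP.EGRS ℓ a (v⁻¹ * CodingECP.uVec a))
          (CodingECP.diagNegLast F n))) := by
  have hd := CodingECP.minDist_extHanZhang (by omega) (by omega) ha hv hS
  have hfin := CodingECP.finrank_extHanZhang (by omega) (by omega) ha hv hS
  -- Now `ℓ` is the floor of `(n - k + 1) / 2`: `n + 1 = k + 2ℓ` with `ℓ ≥ 2` in the odd case, `n =
  -- k + 2ℓ` in the even case.
  rw [hd, ENat.toNat_natCast] at hℓ
  refine ⟨⟨hfin, hd⟩, fun hodd => ?_, fun heven => ?_⟩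
  · have hgap := hodd
    obtain ⟨m, hm⟩ := hodd
    refine ⟨?_, CodingECP.exists_notMem_range_of_zeroSumFree hkn ha hS hgap, fun γ hγ =>
      CodingECP.isECP_extHanZhang_GRS (by omega) (by omega) ha hv hd hγ⟩
    rintro ⟨A, B, h⟩
    exact CodingECP.not_isELP_extHanZhang hk (by omega) (by omega) ha hv h.toIsELP
  · obtain ⟨m, hm⟩ := heven
    exact CodingECP.isECP_extHanZhang_EGRS (by omega) (by omega) ha hv hd
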